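/- Let $\mathcal G_k(p)$, $k\in\mathbb N$, $p$ prime, be mutually independent random variables with values in $\{0,1,2,\dots\}$ and $\mathbb P\{\mathcal G_k(p)\ge j\}=p^{-j}$ for all $j\ge 0$. For $n,m\in\mathbb N$ put $$\widehat Y_n(m)=\sum_{p\le n}\log p\cdot\max_{1\le k\le m}\mathcal G_k(p),$$ where here and below sums over $p$ extend over prime numbers only. Let $(m_n)$ be a sequence of positive integers with $m_n\to\infty$ and $m_n=o(n)$ as $n\to\infty$, and put $b_n=\tfrac12 m_n(\log^2 n-\log^2 m_n)$. Then $$\frac{\widehat Y_n(m_n)-\sum_{p\le n}\log p\,\bigl(1-(1-p^{-1})^{m_n}\bigr)}{\sqrt{b_n}}$$ converges in distribution, as $n\to\infty$, to a standard normal random variable. Moreover, let $\sqrt{a_n}$ be the norming in the central limit theorem for the logarithm of the least common multiple of $m_n$ independent random variables that are uniformly distributed on $\{1,\dots,n\}$, that is, $$a_n=\begin{cases}\tfrac12 m_n\log^2 m_n,& m_n\le n^{1/2},\\ \tfrac12 m_n(\log n-\log m_n)(3\log m_n-\log n),& m_n>n^{1/2}.\end{cases}$$ Then $\lim_{n\to\infty}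 b_n/a_n=1$ if and only if $\lim_{n\to\infty}\log n/\log m_n=1$. -/

import Mathlib

open MeasureTheory ProbabilityTheory Filter Asymptotics Topology

noncomputable section

/-- The naive geometric model `Ŷ_n(m) = ∑_{p ≤ n} log p · max_{1 ≤ k ≤ m} G_k(p)`, the sum being over
primes. The copies are numbered from `0`, so that `G k p` with `k < m` are the first `m` copies of
`G(p)`; the maximum over no copies is `0`. -/
def geomLogLcm {Ω : Type*} (G : ℕ → ℕ → Ω → ℕ) (n m : ℕ) (ω : Ω) : ℝ :=
  ∑ p ∈ Nat.primesLE n, Real.log p * (((Finset.range m).sup fun k => G k p ω : ℕ) : ℝ)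

/-- The centering `∑_{p ≤ n} log p · (1 - (1 - 1/p)^m)`, the sum being over primes. -/
def geomCentering (n m : ℕ) : ℝ :=
  ∑ p ∈ Nat.primesLE n, Real.log p * (1 - (1 - 1 / (p : ℝ)) ^ m)

/-- The squared norming `m (log² n - log² m) / 2` of the geometric model. -/
def geomNormSq (n m : ℕ) : ℝ :=
  (m : ℝ) * (Real.log n ^ 2 - Real.log m ^ 2) / 2

/-- The squared norming in the central limit theorem for the logarithm of the least common multiple
of `m` independent uniform random elements of `{1, …, n}`: it is `m log² m / 2` if `m ≤ √n`, and
`m (log n - log m) (3 log m - log n) / 2` if `m > √n`. -/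
def lcmNormSq (n m : ℕ) : ℝ :=
  if (m : ℝ) ≤ √(n : ℝ) then (m : ℝ) * Real.log m ^ 2 / 2
  else (m : ℝ) * (Real.log n - Real.log m) * (3 * Real.log m - Real.log n) / 2

end

/-!
The maximum `T` of `m` copies of `G(p)` splits as `T = 1 - 1{T = 0} + (T - 1)⁺`. Correspondingly
the centered model is the sum of two parts
(`geomLogLcm_sub_geomCentering_div`).

* The independent centered Bernoulli terms `log p · (P(T = 0) - 1{T = 0})`, where
  `P(T = 0) = (1 - 1/p)^m`. For `p > m` such a term has variance about `m log² p / p`, while the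
  primes `p ≤ m` contribute only `O(m log n)` in total by Chebyshev's bound. By Mertens' first
  theorem the total variance is therefore `b + O(m log n)` with `b = m (log² n - log² m) / 2`
  (`exists_abs_variance_sub_geomNormSq_le`). As `log n - log m → ∞`, the error is `o(b)`; moreover
  each term is at most `log n = o(√b)`. A central limit theorem for triangular arrays of uniformly
  small bounded variables (`tendstoInDistribution_sum_of_bounded`), proved by comparing
  characteristic functions, gives the standard normal limit.
* The excess `∑ log p · (T - 1)⁺`. Its expectation is at most
  `∑_p log p ∑_{j ≥ 2} min(1, m p⁻ʲ) = O(√m)` (`exists_lintegral_excess_le`), which is `o(√b)`, so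
  that after division by `√b` it tends to `0` in probability. Slutsky's theorem concludes.

Only Chebyshev's upper bound and Mertens' first theorem are needed about the primes; the latter is
derived here from Legendre's formula for `n!`.

For the comparison of the normings, put `x = log n / log m > 1`. The ratio is `x² - 1 ≥ 3` if
`x ≥ 2` and `(x + 1) / (3 - x)` if `x < 2`, so that it tends to `1` exactly when `x` does.
-/

/-! ### Sums over primes -/

lemma sum_primesLE_succ {f : ℕ → ℝ} (n : ℕ) :
    ∑ p ∈ Nat.primesLE (n + 1), f p =
      ∑ p ∈ Nat.primesLE n, f p + if (n + 1).Prime then f (n + 1) else 0 := by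
  rw [Nat.primesLE_succ]
  split_ifs
  · rw [Finset.sum_insert (Nat.notMem_primesLE n), add_comm]
  · simp

lemma sum_log_primesLE_le (n : ℕ) : ∑ p ∈ Nat.primesLE n, Real.log p ≤ Real.log 4 * n := by
  rw [← Chebyshev.theta_eq_sum_primesLE_log]
  exact Chebyshev.theta_le_log4_mul_x (Nat.cast_nonneg n)

/-- Partial summation against Chebyshev's bound `θ(n) ≤ n log 4`, as an induction on `n`: the
boundary term `θ(n) / n²` is carried along. -/
lemma sum_log_div_sq_sub_le {m n : ℕ} (hm : 1 ≤ m) (hmn : m ≤ n) :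
    ∑ p ∈ Nat.primesLE n, Real.log p / (p : ℝ) ^ 2
      - ∑ p ∈ Nat.primesLE m, Real.log p / (p : ℝ) ^ 2 ≤ 2 * Real.log 4 / m := by
  have key : ∑ p ∈ Nat.primesLE n, Real.log p / (p : ℝ) ^ 2
      - ∑ p ∈ Nat.primesLE m, Real.log p / (p : ℝ) ^ 2 ≤
      (∑ p ∈ Nat.primesLE n, Real.log p) / (n : ℝ) ^ 2
        + 2 * Real.log 4 * (1 / (m : ℝ) - 1 / n) := by
    induction n, hmn using Nat.le_induction with
    | base =>
      have : 0 ≤ ∑ p ∈ Nat.primesLE m, Real.log p :=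
        Finset.sum_nonneg fun p _ => Real.log_natCast_nonneg p
      simp only [sub_self, mul_zero, add_zero]
      positivity
    | succ n hmn ih =>
      have hn : (0 : ℝ) < n := by exact_mod_cast (by omega : 0 < n)
      have hθ := sum_log_primesLE_le n
      have h4 : 0 ≤ Real.log 4 := Real.log_nonneg (by norm_num)
      rw [sum_primesLE_succ (f := fun p => Real.log p / (p : ℝ) ^ 2),
        sum_primesLE_succ (f := fun p => Real.log p)]
      set θ := ∑ p ∈ Nat.primesLE n, Real.log p
      set x : ℝ := if (n + 1).Prime then Real.log ((n + 1 : ℕ) : ℝ) else 0 with hx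
      have e : (if (n + 1).Prime then Real.log ((n + 1 : ℕ) : ℝ) / ((n + 1 : ℕ) : ℝ) ^ 2 else 0)
          = x / ((n : ℝ) + 1) ^ 2 := by
        rw [hx]; split_ifs <;> simp
      rw [e]
      push_cast
      have h1 : θ * (1 / (n : ℝ) ^ 2 - 1 / ((n : ℝ) + 1) ^ 2) ≤
          2 * Real.log 4 * (1 / (n : ℝ) - 1 / (n + 1)) := by
        have h2 : (1 / (n : ℝ) ^ 2 - 1 / ((n : ℝ) + 1) ^ 2) =
            (2 * n + 1) / ((n : ℝ) ^ 2 * (n + 1) ^ 2) := by field_simp; ring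
        have h3 : 1 / (n : ℝ) - 1 / (n + 1) = 1 / (n * (n + 1)) := by field_simp; ring
        rw [h2, h3]
        calc θ * ((2 * n + 1) / ((n : ℝ) ^ 2 * (n + 1) ^ 2))
            ≤ (Real.log 4 * n) * ((2 * n + 2) / ((n : ℝ) ^ 2 * (n + 1) ^ 2)) := by
              gcongr; norm_num
          _ = _ := by field_simp
      have h5 : (θ + x) / ((n : ℝ) + 1) ^ 2 = θ / (n : ℝ) ^ 2 + x / ((n : ℝ) + 1) ^ 2
          - θ * (1 / (n : ℝ) ^ 2 - 1 / ((n : ℝ) + 1) ^ 2) := by field_simp; ring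
      rw [h5]
      linarith [mul_sub (2 * Real.log 4) (1 / (m : ℝ)) (1 / (n : ℝ)),
        mul_sub (2 * Real.log 4) (1 / (m : ℝ)) (1 / ((n : ℝ) + 1)),
        mul_sub (2 * Real.log 4) (1 / (n : ℝ)) (1 / ((n : ℝ) + 1))]
  have hn : (0 : ℝ) < n := by exact_mod_cast (by omega : 0 < n)
  have h4 : 0 ≤ Real.log 4 := Real.log_nonneg (by norm_num)
  have h6 : (∑ p ∈ Nat.primesLE n, Real.log p) / (n : ℝ) ^ 2 ≤ Real.log 4 / n := by
    rw [div_le_div_iff₀ (by positivity) hn]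
    nlinarith [sum_log_primesLE_le n]
  have h7 : 0 ≤ Real.log 4 / n := by positivity
  calc _ ≤ _ := key
    _ ≤ Real.log 4 / n + 2 * Real.log 4 * (1 / (m : ℝ) - 1 / n) := by gcongr
    _ = 2 * Real.log 4 / m - Real.log 4 / n := by ring
    _ ≤ _ := by linarith

lemma sum_log_div_sq_le (n : ℕ) :
    ∑ p ∈ Nat.primesLE n, Real.log p / (p : ℝ) ^ 2 ≤ 2 * Real.log 4 := by
  rcases Nat.eq_zero_or_pos n with rfl | hn
  · simpa using Real.log_nonneg (by norm_num : (1 : ℝ) ≤ 4)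
  · simpa using sum_log_div_sq_sub_le le_rfl hn

lemma log_factorial_eq_sum (n : ℕ) :
    Real.log (n.factorial : ℝ) =
      ∑ p ∈ Nat.primesLE n, (n.factorial.factorization p : ℝ) * Real.log p := by
  have h : n.factorial = ∏ p ∈ Nat.primesLE n, p ^ n.factorial.factorization p := by
    conv_lhs => rw [← Nat.prod_factorization_pow_eq_self n.factorial_ne_zero]
    refine Finsupp.prod_of_support_subset _ (fun p hp => ?_) _ (by simp)
    rw [Nat.support_factorization, Nat.mem_primeFactors] at hp
    exact Nat.mem_primesLE.2 ⟨(hp.1.dvd_factorial).1 hp.2.1, hp.1⟩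
  conv_lhs => rw [h]
  push_cast
  rw [Real.log_prod]
  · simp
  · intro p hp
    have := (Nat.prime_of_mem_primesLE hp).pos
    positivity

/-- Bounds for the exponent of `p` in `n!`; the upper one is `n / (p - 1) ≤ n / p + 2 n / p²`. -/
lemma factorization_factorial_bounds {p n : ℕ} (hp : p.Prime) :
    (n : ℝ) / p - 1 ≤ (n.factorial.factorization p : ℝ) ∧
      (n.factorial.factorization p : ℝ) ≤ n / p + 2 * (n / (p : ℝ) ^ 2) := by
  have hp2 : (2 : ℝ) ≤ p := by exact_mod_cast hp.two_le
  constructor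
  · have h1 : n / p ≤ n.factorial.factorization p := by
      have h2 : p ^ (n / p) ∣ n.factorial := by
        have h3 : (p * (n / p)).factorial ∣ n.factorial :=
          Nat.factorial_dvd_factorial (Nat.mul_div_le n p)
        refine dvd_trans ?_ h3
        rw [hp.pow_dvd_iff_le_factorization (Nat.factorial_ne_zero _),
          Nat.factorization_factorial_mul hp]
        omega
      exact (hp.pow_dvd_iff_le_factorization (Nat.factorial_ne_zero _)).1 h2
    have h4 : (n : ℝ) / p < (n / p : ℕ) + 1 := by
      rw [div_lt_iff₀ (by positivity)]
      exact_mod_cast (Nat.lt_mul_of_div_lt (Nat.lt_succ_self (n / p)) hp.pos)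
    have h5 : ((n / p : ℕ) : ℝ) ≤ n.factorial.factorization p := by exact_mod_cast h1
    linarith
  · have h1 := Nat.sub_one_mul_factorization_factorial (n := n) hp
    have h2 : (p - 1) * n.factorial.factorization p ≤ n := by rw [h1]; omega
    have h3 : ((p : ℝ) - 1) * n.factorial.factorization p ≤ n := by
      have := (Nat.cast_le (α := ℝ)).2 h2
      rwa [Nat.cast_mul, Nat.cast_sub hp.one_le, Nat.cast_one] at this
    have h4 : (n.factorial.factorization p : ℝ) ≤ n / (p - 1) := by
      rw [le_div_iff₀ (by linarith)]; linarith
    refine h4.trans ?_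
    rw [div_le_iff₀ (by linarith)]
    have : ((n : ℝ) / p + 2 * (n / (p : ℝ) ^ 2)) * (p - 1) = n + n * (p - 2) / (p : ℝ) ^ 2 := by
      field_simp; ring
    rw [this]
    have : 0 ≤ n * ((p : ℝ) - 2) / (p : ℝ) ^ 2 :=
      div_nonneg (mul_nonneg (Nat.cast_nonneg n) (by linarith)) (by positivity)
    linarith

/-- **Mertens' first theorem** with an explicit constant, from Legendre's formula for `n!`. -/
lemma abs_sum_log_div_sub_log_le {n : ℕ} (hn : 1 ≤ n) :
    |∑ p ∈ Nat.primesLE n, Real.log p / p - Real.log n| ≤ 1 + 4 * Real.log 4 := by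
  have hn0 : (0 : ℝ) < n := by exact_mod_cast hn
  have h4 : 0 ≤ Real.log 4 := Real.log_nonneg (by norm_num)
  have hfac := log_factorial_eq_sum n
  have hlog (p : ℕ) : 0 ≤ Real.log p := Real.log_natCast_nonneg p
  have hlow : n * ∑ p ∈ Nat.primesLE n, Real.log p / p - ∑ p ∈ Nat.primesLE n, Real.log p ≤
      Real.log (n.factorial : ℝ) := by
    rw [hfac, Finset.mul_sum, ← Finset.sum_sub_distrib]
    refine Finset.sum_le_sum fun p hp => ?_
    have := mul_le_mul_of_nonneg_right
      (factorization_factorial_bounds (n := n) (Nat.prime_of_mem_primesLE hp)).1 (hlog p)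
    calc _ = ((n : ℝ) / p - 1) * Real.log p := by ring
      _ ≤ _ := this
  have hup : Real.log (n.factorial : ℝ) ≤ n * ∑ p ∈ Nat.primesLE n, Real.log p / p
      + 2 * n * ∑ p ∈ Nat.primesLE n, Real.log p / (p : ℝ) ^ 2 := by
    rw [hfac, Finset.mul_sum, Finset.mul_sum, ← Finset.sum_add_distrib]
    refine Finset.sum_le_sum fun p hp => ?_
    have := mul_le_mul_of_nonneg_right
      (factorization_factorial_bounds (n := n) (Nat.prime_of_mem_primesLE hp)).2 (hlog p)
    calc _ ≤ _ := this
      _ = _ := by ring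
  have hle : Real.log (n.factorial : ℝ) ≤ n * Real.log n := by
    rw [← Real.log_pow]
    exact Real.log_le_log (by exact_mod_cast n.factorial_pos) (by exact_mod_cast n.factorial_le_pow)
  have hge : n * Real.log n - n ≤ Real.log (n.factorial : ℝ) := by
    have h := Stirling.le_log_factorial_stirling (n := n) (by omega)
    have h1 : 0 ≤ Real.log n := hlog n
    have h2 : 0 ≤ Real.log (2 * Real.pi) := Real.log_nonneg (by linarith [Real.pi_gt_three])
    linarith
  have hθ := sum_log_primesLE_le n
  have hsq := mul_le_mul_of_nonneg_left (sum_log_div_sq_le n) (by positivity : (0 : ℝ) ≤ 2 * n)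
  set A := ∑ p ∈ Nat.primesLE n, Real.log p / p
  rw [abs_le]
  constructor
  · have : (n : ℝ) * (-(1 + 4 * Real.log 4)) ≤ n * (A - Real.log n) := by linarith
    exact le_of_mul_le_mul_left this hn0
  · have : (n : ℝ) * (A - Real.log n) ≤ n * (Real.log 4) := by linarith
    linarith [le_of_mul_le_mul_left this hn0]

/-- Partial summation from Mertens' first theorem: if `E` is its error term, then
`∑_{p ≤ n} log² p / p - log² n / 2 - E n * log n` has increments
`O(log (n + 1) - log n)`. -/
lemma abs_sum_log_sq_div_sub_le {n : ℕ} (hn : 1 ≤ n) :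
    |∑ p ∈ Nat.primesLE n, Real.log p ^ 2 / p - Real.log n ^ 2 / 2| ≤
      (3 + 8 * Real.log 4) * Real.log n := by
  have h4 : 0 ≤ Real.log 4 := Real.log_nonneg (by norm_num)
  set E : ℕ → ℝ := fun n => ∑ p ∈ Nat.primesLE n, Real.log p / p - Real.log n with hE
  have key : |∑ p ∈ Nat.primesLE n, Real.log p ^ 2 / p - Real.log n ^ 2 / 2
      - E n * Real.log n| ≤ (2 + 4 * Real.log 4) * Real.log n := by
    induction n, hn using Nat.le_induction with
    | base => simp
    | succ n hn ih =>
      have hn0 : (0 : ℝ) < n := by exact_mod_cast hn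
      have hEn : |E n| ≤ 1 + 4 * Real.log 4 := abs_sum_log_div_sub_log_le hn
      have hE1 : E (n + 1) = E n + (if (n + 1).Prime then
          Real.log ((n + 1 : ℕ) : ℝ) / ((n + 1 : ℕ) : ℝ) else 0)
          - (Real.log ((n + 1 : ℕ) : ℝ) - Real.log n) := by
        simp only [hE]
        rw [sum_primesLE_succ (f := fun p => Real.log p / p)]
        ring
      rw [hE1, sum_primesLE_succ (f := fun p => Real.log p ^ 2 / p)]
      have hd0 : 0 ≤ Real.log ((n + 1 : ℕ) : ℝ) - Real.log n :=
        sub_nonneg.2 (Real.log_le_log hn0 (by push_cast; linarith))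
      have hd1 : Real.log ((n + 1 : ℕ) : ℝ) - Real.log n ≤ 1 := by
        rw [← Real.log_div (by positivity) hn0.ne']
        refine (Real.log_le_sub_one_of_pos (by positivity)).trans ?_
        push_cast
        rw [add_div, div_self hn0.ne', add_sub_cancel_left, div_le_one hn0]
        exact_mod_cast hn
      set l' := Real.log ((n + 1 : ℕ) : ℝ)
      set l := Real.log (n : ℝ)
      set V := ∑ p ∈ Nat.primesLE n, Real.log p ^ 2 / p
      have e : (if (n + 1).Prime then l' ^ 2 / ((n + 1 : ℕ) : ℝ) else 0) =
          l' * (if (n + 1).Prime then l' / ((n + 1 : ℕ) : ℝ) else 0) := by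
        split_ifs <;> ring
      rw [e]
      set x := (if (n + 1).Prime then l' / ((n + 1 : ℕ) : ℝ) else 0)
      have h1 : V + l' * x - l' ^ 2 / 2 - (E n + x - (l' - l)) * l' =
          (V - l ^ 2 / 2 - E n * l) + (l' - l) * ((l' - l) / 2 - E n) := by ring
      rw [h1]
      have h2 : |(l' - l) * ((l' - l) / 2 - E n)| ≤ (l' - l) * (2 + 4 * Real.log 4) := by
        rw [abs_mul, abs_of_nonneg hd0]
        refine mul_le_mul_of_nonneg_left ?_ hd0
        rw [abs_le] at hEn ⊢
        constructor <;> linarith [hEn.1, hEn.2]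
      calc _ ≤ _ := abs_add_le _ _
        _ ≤ (2 + 4 * Real.log 4) * l + (l' - l) * (2 + 4 * Real.log 4) := add_le_add ih h2
        _ = _ := by ring
  have h5 : |E n * Real.log n| ≤ (1 + 4 * Real.log 4) * Real.log n := by
    rw [abs_mul, abs_of_nonneg (Real.log_natCast_nonneg n)]
    exact mul_le_mul_of_nonneg_right (abs_sum_log_div_sub_log_le hn) (Real.log_natCast_nonneg n)
  rw [abs_le] at *
  constructor <;> linarith [key.1, key.2, h5.1, h5.2]

/-- Uniform boundedness of `∑_{p ≤ n} log p / p ^ (3/2)`. -/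
lemma exists_sum_log_div_rpow_le :
    ∃ K : ℝ, 0 ≤ K ∧ ∀ n : ℕ, ∑ p ∈ Nat.primesLE n, Real.log p / (p * √p) ≤ K := by
  have hs : Summable fun k : ℕ => 4 * (1 / (k : ℝ) ^ (5 / 4 : ℝ)) :=
    (Real.summable_one_div_nat_rpow.2 (by norm_num)).mul_left 4
  refine ⟨∑' k : ℕ, 4 * (1 / (k : ℝ) ^ (5 / 4 : ℝ)), tsum_nonneg fun k => by positivity,
    fun n => ?_⟩
  refine (Finset.sum_le_sum fun p hp => ?_).trans
    (hs.sum_le_tsum (Nat.primesLE n) fun k _ => by positivity)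
  have hp : (0 : ℝ) < p := by exact_mod_cast (Nat.prime_of_mem_primesLE hp).pos
  have h1 := Real.log_le_rpow_div hp.le (by norm_num : (0 : ℝ) < 1 / 4)
  have h2 : (p : ℝ) * √p = (p : ℝ) ^ (1 / 4 : ℝ) * (p : ℝ) ^ (5 / 4 : ℝ) := by
    rw [Real.sqrt_eq_rpow, ← Real.rpow_one_add' hp.le (by norm_num), ← Real.rpow_add hp]
    norm_num
  rw [h2, div_le_iff₀ (by positivity)]
  calc _ ≤ _ := h1
    _ = _ := by field_simp

/-! ### Variance of the Bernoulli part and mean of the excess -/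

/-- Probability `(1 - 1/p)^m` that `m` independent geometric variables of parameter `1/p` all
vanish. -/
noncomputable def zeroProb (m p : ℕ) : ℝ := (1 - 1 / (p : ℝ)) ^ m

lemma one_sub_one_div_prime_nonneg {p : ℕ} (hp : p.Prime) : (0 : ℝ) ≤ 1 - 1 / p := by
  have : (1 : ℝ) ≤ p := by exact_mod_cast hp.one_le
  rw [sub_nonneg, div_le_one (by linarith)]
  exact this

lemma zeroProb_nonneg (m : ℕ) {p : ℕ} (hp : p.Prime) : 0 ≤ zeroProb m p :=
  pow_nonneg (one_sub_one_div_prime_nonneg hp) m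

lemma zeroProb_le_one (m : ℕ) {p : ℕ} (hp : p.Prime) : zeroProb m p ≤ 1 :=
  pow_le_one₀ (one_sub_one_div_prime_nonneg hp) (by simp)

lemma abs_zeroProb_mul_one_sub_sub_le {m p : ℕ} (hp : p.Prime) (hmp : m ≤ p) :
    |zeroProb m p * (1 - zeroProb m p) - m / p| ≤ 2 * ((m : ℝ) / p) ^ 2 := by
  have hp0 : (0 : ℝ) < p := by exact_mod_cast hp.pos
  have hx0 : (0 : ℝ) ≤ (m : ℝ) / p := by positivity
  have hx1 : (m : ℝ) / p ≤ 1 := by rw [div_le_one hp0]; exact_mod_cast hmp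
  have hlow : 1 - (m : ℝ) / p ≤ zeroProb m p := by
    have h := one_add_mul_le_pow (a := -(1 / (p : ℝ)))
      (by linarith [one_sub_one_div_prime_nonneg hp]) m
    calc 1 - (m : ℝ) / p = 1 + m * -(1 / (p : ℝ)) := by ring
      _ ≤ (1 + -(1 / (p : ℝ))) ^ m := h
      _ = zeroProb m p := by rw [zeroProb, sub_eq_add_neg]
  have hup : zeroProb m p ≤ 1 - (m : ℝ) / p + ((m : ℝ) / p) ^ 2 := by
    have h1 : zeroProb m p ≤ Real.exp (-((m : ℝ) / p)) := by
      calc zeroProb m p ≤ Real.exp (-(1 / (p : ℝ))) ^ m := by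
            refine pow_le_pow_left₀ (one_sub_one_div_prime_nonneg hp) ?_ m
            linarith [Real.add_one_le_exp (-(1 / (p : ℝ)))]
        _ = _ := by rw [← Real.exp_nat_mul]; congr 1; ring
    have h2 := (abs_le.1 (Real.abs_exp_sub_one_sub_id_le (x := -((m : ℝ) / p))
      (by rwa [abs_neg, abs_of_nonneg hx0]))).2
    linarith [neg_sq ((m : ℝ) / p)]
  have h0 := zeroProb_nonneg m hp
  have h1 := zeroProb_le_one m hp
  set r := zeroProb m p
  set x := (m : ℝ) / p
  rw [abs_le]
  constructor
  · have : (1 - x) * (x - x ^ 2) ≤ r * (1 - r) :=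
      mul_le_mul hlow (by linarith) (by nlinarith) h0
    nlinarith [pow_nonneg hx0 3]
  · nlinarith [sq_nonneg x]

/-- The variance of the Bernoulli part equals the squared norming up to `O(m log n)`. Primes
`p ≤ m` contribute `O(m log n)` by Chebyshev's bound, while for `p > m` the Bernoulli variance is
`m / p + O(m² / p²)`. -/
lemma exists_abs_variance_sub_geomNormSq_le :
    ∃ C : ℝ, 0 ≤ C ∧ ∀ m n : ℕ, 1 ≤ m → m ≤ n →
      |∑ p ∈ Nat.primesLE n, Real.log p ^ 2 * (zeroProb m p * (1 - zeroProb m p))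
        - geomNormSq n m| ≤ C * (m * Real.log n) := by
  have h4 : 0 ≤ Real.log 4 := Real.log_nonneg (by norm_num)
  refine ⟨Real.log 4 + 4 * Real.log 4 + 2 * (3 + 8 * Real.log 4), by positivity,
    fun m n hm hmn => ?_⟩
  have hm0 : (0 : ℝ) < m := by exact_mod_cast hm
  have hL : 0 ≤ Real.log n := Real.log_natCast_nonneg n
  have hML : Real.log m ≤ Real.log n := Real.log_le_log hm0 (by exact_mod_cast hmn)
  have hsub : Nat.primesLE m ⊆ Nat.primesLE n := Nat.primesLE_mono hmn
  have hlogle : ∀ p ∈ Nat.primesLE n, Real.log p ≤ Real.log n := fun p hp =>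
    Real.log_le_log (by exact_mod_cast (Nat.prime_of_mem_primesLE hp).pos)
      (by exact_mod_cast Nat.le_of_mem_primesLE hp)
  have hlog0 (p : ℕ) : 0 ≤ Real.log p := Real.log_natCast_nonneg p
  set f : ℕ → ℝ := fun p => Real.log p ^ 2 * (zeroProb m p * (1 - zeroProb m p)) with hf
  have hsmall : |∑ p ∈ Nat.primesLE m, f p| ≤ Real.log 4 * (m * Real.log n) := by
    refine (Finset.abs_sum_le_sum_abs _ _).trans ?_
    calc ∑ p ∈ Nat.primesLE m, |f p| ≤ ∑ p ∈ Nat.primesLE m, Real.log n * Real.log p := by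
          refine Finset.sum_le_sum fun p hp => ?_
          have h0 := zeroProb_nonneg m (Nat.prime_of_mem_primesLE hp)
          have h1 := zeroProb_le_one m (Nat.prime_of_mem_primesLE hp)
          have h2 : 0 ≤ zeroProb m p * (1 - zeroProb m p) := mul_nonneg h0 (by linarith)
          rw [hf, abs_of_nonneg (mul_nonneg (sq_nonneg _) h2)]
          calc _ ≤ Real.log p ^ 2 * 1 := by gcongr; nlinarith
            _ = Real.log p * Real.log p := by ring
            _ ≤ _ := mul_le_mul_of_nonneg_right (hlogle p (hsub hp)) (hlog0 p)
      _ = Real.log n * ∑ p ∈ Nat.primesLE m, Real.log p := by rw [Finset.mul_sum]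
      _ ≤ Real.log n * (Real.log 4 * m) := by gcongr; exact sum_log_primesLE_le m
      _ = _ := by ring
  have hlarge : |∑ p ∈ Nat.primesLE n \ Nat.primesLE m, (f p - m * (Real.log p ^ 2 / p))| ≤
      4 * Real.log 4 * (m * Real.log n) := by
    refine (Finset.abs_sum_le_sum_abs _ _).trans ?_
    calc ∑ p ∈ Nat.primesLE n \ Nat.primesLE m, |f p - m * (Real.log p ^ 2 / p)|
        ≤ ∑ p ∈ Nat.primesLE n \ Nat.primesLE m,
            2 * (m : ℝ) ^ 2 * Real.log n * (Real.log p / (p : ℝ) ^ 2) := by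
          refine Finset.sum_le_sum fun p hp => ?_
          obtain ⟨hpn, hpm⟩ := Finset.mem_sdiff.1 hp
          have hpp := Nat.prime_of_mem_primesLE hpn
          have hmp : m ≤ p := by
            by_contra h
            exact hpm (Nat.mem_primesLE.2 ⟨by omega, hpp⟩)
          have hp0 : (0 : ℝ) < p := by exact_mod_cast hpp.pos
          have e : f p - m * (Real.log p ^ 2 / p) =
              Real.log p ^ 2 * (zeroProb m p * (1 - zeroProb m p) - m / p) := by
            rw [hf]; ring
          rw [e, abs_mul, abs_of_nonneg (sq_nonneg _)]
          calc _ ≤ Real.log p ^ 2 * (2 * ((m : ℝ) / p) ^ 2) := by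
                gcongr; exact abs_zeroProb_mul_one_sub_sub_le hpp hmp
            _ = 2 * (m : ℝ) ^ 2 * Real.log p * (Real.log p / (p : ℝ) ^ 2) := by
                field_simp
            _ ≤ _ := by
                have := hlogle p hpn
                have := hlog0 p
                gcongr
      _ = 2 * (m : ℝ) ^ 2 * Real.log n * (∑ p ∈ Nat.primesLE n, Real.log p / (p : ℝ) ^ 2
            - ∑ p ∈ Nat.primesLE m, Real.log p / (p : ℝ) ^ 2) := by
          rw [← Finset.mul_sum, ← Finset.sum_sdiff hsub, add_sub_cancel_right]
      _ ≤ 2 * (m : ℝ) ^ 2 * Real.log n * (2 * Real.log 4 / m) := by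
          gcongr; exact sum_log_div_sq_sub_le hm hmn
      _ = _ := by field_simp; ring
  have hn' := abs_sum_log_sq_div_sub_le (hm.trans hmn)
  have hm' := (abs_sum_log_sq_div_sub_le hm).trans
    (mul_le_mul_of_nonneg_left hML (by positivity))
  have e1 := Finset.sum_sdiff (f := f) hsub
  have e2 := Finset.sum_sdiff (f := fun p : ℕ => Real.log p ^ 2 / (p : ℝ)) hsub
  rw [Finset.sum_sub_distrib, ← Finset.mul_sum] at hlarge
  have e : ∑ p ∈ Nat.primesLE n, f p - geomNormSq n m =
      ∑ p ∈ Nat.primesLE m, f p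
      + (∑ p ∈ Nat.primesLE n \ Nat.primesLE m, f p
        - m * ∑ p ∈ Nat.primesLE n \ Nat.primesLE m, Real.log p ^ 2 / (p : ℝ))
      + m * ((∑ p ∈ Nat.primesLE n, Real.log p ^ 2 / (p : ℝ) - Real.log n ^ 2 / 2)
        - (∑ p ∈ Nat.primesLE m, Real.log p ^ 2 / (p : ℝ) - Real.log m ^ 2 / 2)) := by
    rw [← e1, ← e2, geomNormSq]; ring
  rw [e]
  have h3 : |m * ((∑ p ∈ Nat.primesLE n, Real.log p ^ 2 / (p : ℝ) - Real.log n ^ 2 / 2)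
        - (∑ p ∈ Nat.primesLE m, Real.log p ^ 2 / (p : ℝ) - Real.log m ^ 2 / 2))| ≤
      2 * (3 + 8 * Real.log 4) * (m * Real.log n) := by
    rw [abs_mul, abs_of_pos hm0]
    calc _ ≤ (m : ℝ) *
          ((3 + 8 * Real.log 4) * Real.log n + (3 + 8 * Real.log 4) * Real.log n) := by
          refine mul_le_mul_of_nonneg_left ?_ hm0.le
          exact (abs_sub _ _).trans (add_le_add hn' hm')
      _ = _ := by ring
  refine (abs_add_three _ _ _).trans ?_
  linarith

/-- The sum `∑_p log p ∑_{j ≥ 2} min(1, m p⁻ʲ)` is `O(√m)`: the term `j = 2` through Chebyshev's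
bound at `√m`, the terms `j ≥ 3` through `min(1, x) ≤ √x`. -/
lemma exists_sum_log_mul_min_le :
    ∃ C : ℝ, 0 ≤ C ∧ ∀ m n : ℕ, 1 ≤ m →
      ∑ p ∈ Nat.primesLE n, Real.log p * (min 1 ((m : ℝ) / (p : ℝ) ^ 2)
        + 4 * (√m / (p * √p))) ≤ C * √m := by
  have h4 : 0 ≤ Real.log 4 := Real.log_nonneg (by norm_num)
  obtain ⟨K, hK0, hK⟩ := exists_sum_log_div_rpow_le
  refine ⟨Real.log 4 + 4 * Real.log 4 + 4 * K, by positivity, fun m n hm => ?_⟩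
  have hlog0 (p : ℕ) : 0 ≤ Real.log p := Real.log_natCast_nonneg p
  have hm0 : (0 : ℝ) < m := by exact_mod_cast hm
  set s := m.sqrt with hs
  have hs1 : 1 ≤ s := Nat.sqrt_pos.2 hm
  have hs0 : (0 : ℝ) < s := by exact_mod_cast hs1
  have hsle : (s : ℝ) ≤ √m := Real.nat_sqrt_le_real_sqrt
  have hsge : √m ≤ 2 * s := by
    have := Real.real_sqrt_le_nat_sqrt_succ (a := m)
    have h1 : (1 : ℝ) ≤ s := by exact_mod_cast hs1
    linarith
  have hmin : ∑ p ∈ Nat.primesLE n, Real.log p * min 1 ((m : ℝ) / (p : ℝ) ^ 2) ≤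
      Real.log 4 * √m + 4 * Real.log 4 * √m := by
    set N := max n s
    have hsub : Nat.primesLE s ⊆ Nat.primesLE N := Nat.primesLE_mono (le_max_right _ _)
    calc ∑ p ∈ Nat.primesLE n, Real.log p * min 1 ((m : ℝ) / (p : ℝ) ^ 2)
        ≤ ∑ p ∈ Nat.primesLE N, Real.log p * min 1 ((m : ℝ) / (p : ℝ) ^ 2) :=
          Finset.sum_le_sum_of_subset_of_nonneg (Nat.primesLE_mono (le_max_left _ _))
            fun p _ _ => mul_nonneg (hlog0 p) (le_min zero_le_one (by positivity))
      _ = ∑ p ∈ Nat.primesLE N \ Nat.primesLE s, Real.log p * min 1 ((m : ℝ) / (p : ℝ) ^ 2)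
          + ∑ p ∈ Nat.primesLE s, Real.log p * min 1 ((m : ℝ) / (p : ℝ) ^ 2) :=
          (Finset.sum_sdiff hsub).symm
      _ ≤ ∑ p ∈ Nat.primesLE N \ Nat.primesLE s, m * (Real.log p / (p : ℝ) ^ 2)
          + ∑ p ∈ Nat.primesLE s, Real.log p := by
          refine add_le_add (Finset.sum_le_sum fun p _ => ?_) (Finset.sum_le_sum fun p _ => ?_)
          · calc _ ≤ Real.log p * ((m : ℝ) / (p : ℝ) ^ 2) :=
                  mul_le_mul_of_nonneg_left (min_le_right _ _) (hlog0 p)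
              _ = _ := by ring
          · exact mul_le_of_le_one_right (hlog0 p) (min_le_left _ _)
      _ = m * (∑ p ∈ Nat.primesLE N, Real.log p / (p : ℝ) ^ 2
            - ∑ p ∈ Nat.primesLE s, Real.log p / (p : ℝ) ^ 2)
          + ∑ p ∈ Nat.primesLE s, Real.log p := by
          rw [← Finset.mul_sum, ← Finset.sum_sdiff hsub, add_sub_cancel_right]
      _ ≤ m * (2 * Real.log 4 / s) + Real.log 4 * s := by
          gcongr
          · exact sum_log_div_sq_sub_le hs1 (le_max_right _ _)
          · exact sum_log_primesLE_le s
      _ ≤ 4 * Real.log 4 * √m + Real.log 4 * √m := by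
          refine add_le_add ?_ (mul_le_mul_of_nonneg_left hsle h4)
          rw [← mul_div_assoc, div_le_iff₀ hs0]
          nlinarith [Real.mul_self_sqrt hm0.le, Real.sqrt_nonneg (m : ℝ),
            mul_le_mul_of_nonneg_left hsge (mul_nonneg h4 (Real.sqrt_nonneg (m : ℝ)))]
      _ = _ := by ring
  have hrest : ∑ p ∈ Nat.primesLE n, Real.log p * (4 * (√m / (p * √p))) ≤ 4 * K * √m := by
    calc _ = 4 * √m * ∑ p ∈ Nat.primesLE n, Real.log p / (p * √p) := by
          rw [Finset.mul_sum]
          exact Finset.sum_congr rfl fun p _ => by ring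
      _ ≤ 4 * √m * K := by gcongr; exact hK n
      _ = _ := by ring
  simp_rw [mul_add, Finset.sum_add_distrib]
  linarith

/-! ### A central limit theorem for uniformly small bounded variables -/

lemma norm_prod_sub_prod_le_sum {ι : Type*} (s : Finset ι) (f g : ι → ℂ)
    (hf : ∀ i ∈ s, ‖f i‖ ≤ 1) (hg : ∀ i ∈ s, ‖g i‖ ≤ 1) :
    ‖∏ i ∈ s, f i - ∏ i ∈ s, g i‖ ≤ ∑ i ∈ s, ‖f i - g i‖ := by
  classical
  induction s using Finset.induction_on with
  | empty => simp
  | insert a s ha ih =>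
    rw [Finset.prod_insert ha, Finset.prod_insert ha, Finset.sum_insert ha]
    have hs := ih (fun i hi => hf i (Finset.mem_insert_of_mem hi))
      (fun i hi => hg i (Finset.mem_insert_of_mem hi))
    have hF : ‖∏ i ∈ s, f i‖ ≤ 1 := by
      rw [norm_prod]
      exact Finset.prod_le_one (fun _ _ => norm_nonneg _)
        fun i hi => hf i (Finset.mem_insert_of_mem hi)
    have hga := hg a (Finset.mem_insert_self a s)
    have e : f a * ∏ i ∈ s, f i - g a * ∏ i ∈ s, g i =
        (f a - g a) * ∏ i ∈ s, f i + g a * (∏ i ∈ s, f i - ∏ i ∈ s, g i) := by ring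
    rw [e]
    refine (norm_add_le _ _).trans (add_le_add ?_ ?_)
    · rw [norm_mul]
      exact mul_le_of_le_one_right (norm_nonneg _) hF
    · rw [norm_mul]
      exact (mul_le_of_le_one_left (norm_nonneg _) hga).trans hs

lemma norm_cexp_mul_I_sub_le {x : ℝ} (hx : |x| ≤ 1) :
    ‖Complex.exp (x * Complex.I) - (1 + x * Complex.I - x ^ 2 / 2)‖ ≤ |x| ^ 3 := by
  have hn : ‖(x : ℂ) * Complex.I‖ = |x| := by simp
  have h := Complex.exp_bound (x := x * Complex.I) (by rwa [hn]) (n := 3) (by norm_num)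
  rw [hn] at h
  have e : ∑ m ∈ Finset.range 3, ((x : ℂ) * Complex.I) ^ m / (m.factorial : ℂ) =
      1 + x * Complex.I - x ^ 2 / 2 := by
    simp [Finset.sum_range_succ, Nat.factorial, mul_pow]
    ring
  rw [e] at h
  refine h.trans (mul_le_of_le_one_right (by positivity) ?_)
  norm_num [Nat.factorial]

/-- Second order expansion of the characteristic function of a centered bounded variable, compared
with a Gaussian of the same variance. -/
lemma norm_charFun_sub_exp_le {Ω : Type*} [MeasurableSpace Ω] {P : Measure Ω}
    [IsProbabilityMeasure P] {X : Ω → ℝ} (hX : Measurable X) {ε : ℝ}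
    (hbd : ∀ ω, |X ω| ≤ ε) (h0 : ∫ ω, X ω ∂P = 0) {t : ℝ} (ht : |t| * ε ≤ 1) :
    ‖charFun (P.map X) t - Complex.exp ((-(t ^ 2 * (∫ ω, X ω ^ 2 ∂P) / 2) : ℝ))‖ ≤
      (|t| ^ 3 * ε + t ^ 4 * ε ^ 2) * ∫ ω, X ω ^ 2 ∂P := by
  have hε : 0 ≤ ε := by
    obtain ⟨ω⟩ := nonempty_of_isProbabilityMeasure P
    exact (abs_nonneg _).trans (hbd ω)
  have hint : Integrable X P := .of_bound hX.aestronglyMeasurable ε (ae_of_all _ hbd)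
  have hsqle (ω) : X ω ^ 2 ≤ ε ^ 2 := sq_le_sq.2 (by rw [abs_of_nonneg hε]; exact hbd ω)
  have hint2 : Integrable (fun ω => X ω ^ 2) P :=
    .of_bound (hX.pow_const 2).aestronglyMeasurable (ε ^ 2) (ae_of_all _ fun ω => by
      rw [Real.norm_of_nonneg (sq_nonneg _)]; exact hsqle ω)
  set v := ∫ ω, X ω ^ 2 ∂P with hv
  have hv0 : 0 ≤ v := integral_nonneg fun ω => sq_nonneg _
  have hvle : v ≤ ε ^ 2 := by
    calc v ≤ ∫ _, ε ^ 2 ∂P := integral_mono hint2 (integrable_const _) hsqle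
      _ = ε ^ 2 := by simp
  have hchar : charFun (P.map X) t = ∫ ω, Complex.exp ((t * X ω : ℝ) * Complex.I) ∂P := by
    rw [charFun_apply_real, integral_map hX.aemeasurable (by fun_prop)]
    simp
  have hexpint : Integrable (fun ω => Complex.exp ((t * X ω : ℝ) * Complex.I)) P := by
    refine .of_bound (by fun_prop) 1 (ae_of_all _ fun ω => ?_)
    rw [Complex.norm_exp_ofReal_mul_I]
  have hpoly : Integrable (fun ω => (1 : ℂ) + (t * X ω : ℝ) * Complex.I
      - ((t * X ω : ℝ) : ℂ) ^ 2 / 2) P := by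
    have h1 : Integrable (fun ω => ((t * X ω : ℝ) : ℂ) * Complex.I) P :=
      ((hint.const_mul t).ofReal (𝕜 := ℂ)).mul_const _
    have h2 : Integrable (fun ω => ((t * X ω : ℝ) : ℂ) ^ 2 / 2) P := by
      have := ((hint2.const_mul (t ^ 2 / 2)).ofReal (𝕜 := ℂ))
      refine this.congr (ae_of_all _ fun ω => ?_)
      simp only [Complex.coe_algebraMap]
      push_cast
      ring
    exact ((integrable_const _).add h1).sub h2
  have hpolyval : ∫ ω, ((1 : ℂ) + (t * X ω : ℝ) * Complex.I - ((t * X ω : ℝ) : ℂ) ^ 2 / 2) ∂P =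
      ((1 - t ^ 2 * v / 2 : ℝ) : ℂ) := by
    have e : ∀ ω, ((1 : ℂ) + (t * X ω : ℝ) * Complex.I - ((t * X ω : ℝ) : ℂ) ^ 2 / 2) =
        ((1 - t ^ 2 / 2 * X ω ^ 2 : ℝ) : ℂ) + ((t * X ω : ℝ) : ℂ) * Complex.I := fun ω => by
      push_cast; ring
    simp_rw [e]
    rw [integral_add, integral_complex_ofReal, integral_mul_const, integral_complex_ofReal,
      integral_sub (integrable_const _) (hint2.const_mul _), integral_const_mul,
      integral_const_mul, h0]
    · simp only [integral_const, probReal_univ, smul_eq_mul, mul_one, mul_zero,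
        Complex.ofReal_zero, zero_mul, add_zero]
      congr 1
      rw [← hv]; ring
    · exact ((integrable_const _).sub (hint2.const_mul _)).ofReal (𝕜 := ℂ)
    · exact ((hint.const_mul t).ofReal (𝕜 := ℂ)).mul_const _
  have htaylor : ‖charFun (P.map X) t - ((1 - t ^ 2 * v / 2 : ℝ) : ℂ)‖ ≤ |t| ^ 3 * ε * v := by
    rw [hchar, ← hpolyval, ← integral_sub hexpint hpoly]
    calc _ ≤ ∫ ω, |t| ^ 3 * ε * X ω ^ 2 ∂P := by
          refine norm_integral_le_of_norm_le (hint2.const_mul _) (ae_of_all _ fun ω => ?_)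
          have htX : |t * X ω| ≤ 1 := by
            rw [abs_mul]
            exact (mul_le_mul_of_nonneg_left (hbd ω) (abs_nonneg t)).trans ht
          refine (norm_cexp_mul_I_sub_le htX).trans ?_
          rw [abs_mul, mul_pow, ← sq_abs (X ω)]
          calc |t| ^ 3 * |X ω| ^ 3 = |t| ^ 3 * |X ω| * |X ω| ^ 2 := by ring
            _ ≤ |t| ^ 3 * ε * |X ω| ^ 2 := by gcongr; exact hbd ω
      _ = _ := by rw [integral_const_mul]
  have htv : t ^ 2 * v ≤ 1 := by
    calc t ^ 2 * v ≤ t ^ 2 * ε ^ 2 := by gcongr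
      _ = (|t| * ε) ^ 2 := by rw [mul_pow, sq_abs]
      _ ≤ 1 := pow_le_one₀ (by positivity) ht
  have hgauss : ‖((1 - t ^ 2 * v / 2 : ℝ) : ℂ) - Complex.exp ((-(t ^ 2 * v / 2) : ℝ))‖ ≤
      t ^ 4 * ε ^ 2 * v := by
    rw [← Complex.ofReal_exp, ← Complex.ofReal_sub, Complex.norm_real, Real.norm_eq_abs, abs_sub_comm]
    have h0' : 0 ≤ t ^ 2 * v / 2 := by positivity
    have h := Real.abs_exp_sub_one_sub_id_le (x := -(t ^ 2 * v / 2))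
      (by rw [abs_neg, abs_of_nonneg h0']; linarith)
    calc _ = |Real.exp (-(t ^ 2 * v / 2)) - 1 - -(t ^ 2 * v / 2)| := by congr 1; ring
      _ ≤ _ := h
      _ = t ^ 4 * (v / 4) * v := by ring
      _ ≤ _ := by gcongr; linarith
  calc _ ≤ _ := norm_sub_le_norm_sub_add_norm_sub _ ((1 - t ^ 2 * v / 2 : ℝ) : ℂ) _
    _ ≤ |t| ^ 3 * ε * v + t ^ 4 * ε ^ 2 * v := add_le_add htaylor hgauss
    _ = _ := by ring

/-- The characteristic function of a sum of independent centered bounded variables is close to the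
Gaussian one of the same variance: all factors have modulus at most `1`, so the errors add up. -/
lemma norm_charFun_sum_sub_exp_le {Ω ι : Type*} [MeasurableSpace Ω] {P : Measure Ω}
    [IsProbabilityMeasure P] {X : ι → Ω → ℝ} (s : Finset ι) (hX : ∀ i, Measurable (X i))
    (hind : iIndepFun X P) {ε : ℝ} (hbd : ∀ i ∈ s, ∀ ω, |X i ω| ≤ ε)
    (h0 : ∀ i, ∫ ω, X i ω ∂P = 0) {t : ℝ} (ht : |t| * ε ≤ 1) :
    ‖charFun (P.map fun ω => ∑ i ∈ s, X i ω) t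
      - Complex.exp ((-(t ^ 2 * (∑ i ∈ s, ∫ ω, X i ω ^ 2 ∂P) / 2) : ℝ))‖ ≤
      (|t| ^ 3 * ε + t ^ 4 * ε ^ 2) * ∑ i ∈ s, ∫ ω, X i ω ^ 2 ∂P := by
  have hexp : Complex.exp ((-(t ^ 2 * (∑ i ∈ s, ∫ ω, X i ω ^ 2 ∂P) / 2) : ℝ)) =
      ∏ i ∈ s, Complex.exp ((-(t ^ 2 * (∫ ω, X i ω ^ 2 ∂P) / 2) : ℝ)) := by
    rw [← Complex.exp_sum, ← Complex.ofReal_sum, Finset.sum_neg_distrib, ← Finset.sum_div,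
      ← Finset.mul_sum]
  rw [(hind.restrict s).charFun_map_fun_finsetSum_eq_prod fun i _ => (hX i).aemeasurable, hexp,
    Finset.prod_apply, Finset.mul_sum]
  have hprob (i : ι) : IsProbabilityMeasure (P.map (X i)) :=
    Measure.isProbabilityMeasure_map (hX i).aemeasurable
  refine (norm_prod_sub_prod_le_sum s _ _ (fun i _ => norm_charFun_le_one t) fun i _ => ?_).trans
    (Finset.sum_le_sum fun i hi => norm_charFun_sub_exp_le (hX i) (hbd i hi) (h0 i) ht)
  rw [← Complex.ofReal_exp, Complex.norm_real, Real.norm_of_nonneg (Real.exp_nonneg _),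
    Real.exp_le_one_iff, neg_nonpos]
  have : 0 ≤ ∫ ω, X i ω ^ 2 ∂P := integral_nonneg fun ω => sq_nonneg _
  positivity

/-- **Central limit theorem** for a triangular array, independent within rows, of centered variables
bounded by `ε n → 0`, with total variance tending to `1`. -/
theorem tendstoInDistribution_sum_of_bounded {Ω ι : Type*} [MeasurableSpace Ω] {P : Measure Ω}
    [IsProbabilityMeasure P] {X : ℕ → ι → Ω → ℝ} (s : ℕ → Finset ι)
    (hX : ∀ n i, Measurable (X n i)) (hind : ∀ n, iIndepFun (X n) P) {ε : ℕ → ℝ}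
    (hbd : ∀ᶠ n in atTop, ∀ i ∈ s n, ∀ ω, |X n i ω| ≤ ε n) (hε : Tendsto ε atTop (𝓝 0))
    (h0 : ∀ n i, ∫ ω, X n i ω ∂P = 0)
    (hvar : Tendsto (fun n => ∑ i ∈ s n, ∫ ω, X n i ω ^ 2 ∂P) atTop (𝓝 1)) :
    TendstoInDistribution (fun n ω => ∑ i ∈ s n, X n i ω) atTop (id : ℝ → ℝ) (fun _ => P)
      (gaussianReal 0 1) where
  forall_aemeasurable n := Finset.aemeasurable_fun_sum _ fun i _ => (hX n i).aemeasurable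
  tendsto := by
    refine ProbabilityMeasure.tendsto_iff_tendsto_charFun.2 fun t => ?_
    simp only [ProbabilityMeasure.coe_mk, Measure.map_id, charFun_gaussianReal]
    have hlim : Tendsto (fun n => Complex.exp
        ((-(t ^ 2 * (∑ i ∈ s n, ∫ ω, X n i ω ^ 2 ∂P) / 2) : ℝ))) atTop
        (𝓝 (Complex.exp ((-(t ^ 2 * 1 / 2) : ℝ)))) := by
      refine (Complex.continuous_exp.comp Complex.continuous_ofReal).continuousAt.tendsto.comp ?_
      exact ((hvar.const_mul (t ^ 2)).div_const 2).neg
    have hdiff : Tendsto (fun n => charFun (P.map fun ω => ∑ i ∈ s n, X n i ω) t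
        - Complex.exp ((-(t ^ 2 * (∑ i ∈ s n, ∫ ω, X n i ω ^ 2 ∂P) / 2) : ℝ))) atTop (𝓝 0) := by
      have hb : Tendsto (fun n => (|t| ^ 3 * ε n + t ^ 4 * ε n ^ 2) *
          ∑ i ∈ s n, ∫ ω, X n i ω ^ 2 ∂P) atTop (𝓝 0) := by
        simpa using ((hε.const_mul (|t| ^ 3)).add ((hε.pow 2).const_mul (t ^ 4))).mul hvar
      refine squeeze_zero_norm' ?_ hb
      have ht : ∀ᶠ n in atTop, |t| * ε n < 1 := by
        have := hε.const_mul |t|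
        rw [mul_zero] at this
        exact this.eventually_lt_const zero_lt_one
      filter_upwards [hbd, ht] with n hn htn
      exact norm_charFun_sum_sub_exp_le (s n) (hX n) (hind n) hn (h0 n) htn.le
    have := hdiff.add hlim
    simp only [sub_add_cancel, zero_add] at this
    convert this using 2
    push_cast
    ring_nf

/-! ### The geometric model -/

/-- The primes up to `n` as a finite subset of the type of primes, which is the type that indexes
the independence of the model. -/
def primesUpTo (n : ℕ) : Finset Nat.Primes := (Nat.primesLE n).subtype Nat.Prime

lemma mem_primesUpTo {n : ℕ} {p : Nat.Primes} : p ∈ primesUpTo n ↔ (p : ℕ) ∈ Nat.primesLE n :=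
  Finset.mem_subtype

lemma sum_primesUpTo (f : ℕ → ℝ) (n : ℕ) :
    ∑ p ∈ primesUpTo n, f p = ∑ p ∈ Nat.primesLE n, f p :=
  Finset.sum_subtype_of_mem f fun _ hp => Nat.prime_of_mem_primesLE hp

section GeometricModel

variable {Ω : Type*} {G : ℕ → ℕ → Ω → ℕ}

/-- The event that the first `m` copies of `G(p)` all vanish. -/
def zeroEvent (G : ℕ → ℕ → Ω → ℕ) (m p : ℕ) : Set Ω := {ω | ∀ k < m, G k p ω = 0}

/-- The maximum of the first `m` copies of `G(p)`; it is `0` if `m = 0`. -/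
def maxCopies (G : ℕ → ℕ → Ω → ℕ) (m p : ℕ) (ω : Ω) : ℕ := (Finset.range m).sup fun k => G k p ω

/-- The centered contribution `log p · (1{max ≥ 1} - P(max ≥ 1)) / c` of the prime `p`, written in
terms of the event that the maximum vanishes. -/
noncomputable def bernoulliTerm (G : ℕ → ℕ → Ω → ℕ) (c : ℝ) (m p : ℕ) (ω : Ω) : ℝ :=
  Real.log p * (zeroProb m p - (zeroEvent G m p).indicator (fun _ => (1 : ℝ)) ω) / c

/-- The part `∑_{p ≤ n} log p · (max - 1)⁺` of the model that the Bernoulli variables `1{max ≥ 1}`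
do not see. -/
noncomputable def excess (G : ℕ → ℕ → Ω → ℕ) (n m : ℕ) (ω : Ω) : ℝ :=
  ∑ p ∈ Nat.primesLE n, Real.log p * ((maxCopies G m p ω - 1 : ℕ) : ℝ)

lemma abs_bernoulliTerm_le {c : ℝ} (hc : 0 ≤ c) (m : ℕ) {p : ℕ} (hp : p.Prime) (ω : Ω) :
    |bernoulliTerm G c m p ω| ≤ Real.log p / c := by
  have h0 := zeroProb_nonneg m hp
  have h1 := zeroProb_le_one m hp
  rw [bernoulliTerm, abs_div, abs_mul, abs_of_nonneg hc, abs_of_nonneg (Real.log_natCast_nonneg p)]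
  refine div_le_div_of_nonneg_right (mul_le_of_le_one_right (Real.log_natCast_nonneg p) ?_) hc
  rw [abs_le]
  by_cases h : ω ∈ zeroEvent G m p
  · rw [Set.indicator_of_mem h]; constructor <;> linarith
  · rw [Set.indicator_of_notMem h]; constructor <;> linarith

/-- Since `max = 1 - 1{max = 0} + (max - 1)⁺`, the centered model is the sum of the Bernoulli terms
and of the excess. -/
lemma geomLogLcm_sub_geomCentering_div (n m : ℕ) (c : ℝ) (ω : Ω) :
    (geomLogLcm G n m ω - geomCentering n m) / c =
      ∑ p ∈ primesUpTo n, bernoulliTerm G c m p ω + excess G n m ω / c := by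
  rw [sum_primesUpTo (bernoulliTerm G c m · ω), geomLogLcm, geomCentering, excess, ← Finset.sum_sub_distrib, Finset.sum_div,
    Finset.sum_div, ← Finset.sum_add_distrib]
  refine Finset.sum_congr rfl fun p _ => ?_
  have h2 : (((Finset.range m).sup fun k => G k p ω : ℕ) : ℝ) =
      1 - (zeroEvent G m p).indicator (fun _ => (1 : ℝ)) ω + ((maxCopies G m p ω - 1 : ℕ) : ℝ) := by
    have h3 : ω ∈ zeroEvent G m p ↔ maxCopies G m p ω = 0 := by
      simp only [zeroEvent, maxCopies, Set.mem_ofPred_eq, ← bot_eq_zero, Finset.sup_eq_bot_iff,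
        Finset.mem_range]
    change ((maxCopies G m p ω : ℕ) : ℝ) = _
    by_cases h : ω ∈ zeroEvent G m p
    · rw [Set.indicator_of_mem h, h3.1 h]; simp
    · rw [Set.indicator_of_notMem h, Nat.cast_sub (Nat.one_le_iff_ne_zero.2 (mt h3.2 h))]
      push_cast
      ring
  rw [h2, bernoulliTerm, zeroProb]
  ring

variable [MeasurableSpace Ω] {P : Measure Ω} [IsProbabilityMeasure P]

lemma measurableSet_zeroEvent (hmeas : ∀ k p : ℕ, p.Prime → Measurable (G k p)) (m : ℕ) {p : ℕ}
    (hp : p.Prime) : MeasurableSet (zeroEvent G m p) := by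
  have : zeroEvent G m p = ⋂ k ∈ Finset.range m, (G k p) ⁻¹' {0} := by
    ext ω; simp [zeroEvent]
  rw [this]
  exact Finset.measurableSet_biInter _ fun k _ => hmeas k p hp (measurableSet_singleton 0)

lemma measurable_maxCopies (hmeas : ∀ k p : ℕ, p.Prime → Measurable (G k p)) (m : ℕ) {p : ℕ}
    (hp : p.Prime) : Measurable (maxCopies G m p) := by
  unfold maxCopies
  induction m with
  | zero => simp
  | succ m ih =>
    simp_rw [Finset.range_add_one, Finset.sup_insert]
    exact (hmeas m p hp).sup ih

lemma measure_preimage_zero (hmeas : ∀ k p : ℕ, p.Prime → Measurable (G k p))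
    (hgeom : ∀ k p j : ℕ, p.Prime → P.real {ω | j ≤ G k p ω} = ((p : ℝ) ^ j)⁻¹) (k : ℕ) {p : ℕ}
    (hp : p.Prime) : P (G k p ⁻¹' {0}) = ENNReal.ofReal (1 - 1 / (p : ℝ)) := by
  have h1 : G k p ⁻¹' {0} = {ω | 1 ≤ G k p ω}ᶜ := by
    ext ω; simp
  have h2 : MeasurableSet {ω | 1 ≤ G k p ω} := measurableSet_le measurable_const (hmeas k p hp)
  rw [← ofReal_measureReal, h1, probReal_compl_eq_one_sub h2, hgeom k p 1 hp]
  simp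

lemma measure_biInter_zeroEvent (hmeas : ∀ k p : ℕ, p.Prime → Measurable (G k p))
    (hgeom : ∀ k p j : ℕ, p.Prime → P.real {ω | j ≤ G k p ω} = ((p : ℝ) ^ j)⁻¹)
    (hindep : iIndepFun (fun i : ℕ × Nat.Primes => G i.1 i.2) P) (m : ℕ) (S : Finset Nat.Primes) :
    P (⋂ p ∈ S, zeroEvent G m p) = ∏ p ∈ S, ENNReal.ofReal (zeroProb m p) := by
  have h1 : ⋂ p ∈ S, zeroEvent G m p =
      ⋂ i ∈ Finset.range m ×ˢ S, (fun ω => G i.1 i.2 ω) ⁻¹' {0} := by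
    ext ω
    simp only [zeroEvent, Set.mem_iInter, Set.mem_ofPred_eq, Finset.mem_product, Finset.mem_range,
      Set.mem_preimage, Set.mem_singleton_iff, Prod.forall]
    exact ⟨fun h k p hkp => h p hkp.2 k hkp.1, fun h p hp k hk => h k p ⟨hk, hp⟩⟩
  rw [h1, hindep.meas_biInter fun i _ => ⟨{0}, measurableSet_singleton 0, rfl⟩,
    Finset.prod_product_right]
  refine Finset.prod_congr rfl fun p _ => ?_
  rw [zeroProb, ENNReal.ofReal_pow (one_sub_one_div_prime_nonneg p.2)]
  calc _ = ∏ _k ∈ Finset.range m, ENNReal.ofReal (1 - 1 / ((p : ℕ) : ℝ)) :=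
        Finset.prod_congr rfl fun k _ => measure_preimage_zero hmeas hgeom k p.2
    _ = _ := by simp

lemma measureReal_zeroEvent (hmeas : ∀ k p : ℕ, p.Prime → Measurable (G k p))
    (hgeom : ∀ k p j : ℕ, p.Prime → P.real {ω | j ≤ G k p ω} = ((p : ℝ) ^ j)⁻¹)
    (hindep : iIndepFun (fun i : ℕ × Nat.Primes => G i.1 i.2) P) (m : ℕ) (p : Nat.Primes) :
    P.real (zeroEvent G m p) = zeroProb m p := by
  have h := measure_biInter_zeroEvent hmeas hgeom hindep m {p}
  simp only [Finset.mem_singleton, Set.iInter_iInter_eq_left, Finset.prod_singleton] at h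
  rw [measureReal_def, h, ENNReal.toReal_ofReal (zeroProb_nonneg m p.2)]

/-- The events for distinct primes are independent since they are built from disjoint blocks of the
family `G`. -/
lemma iIndepSet_zeroEvent (hmeas : ∀ k p : ℕ, p.Prime → Measurable (G k p))
    (hgeom : ∀ k p j : ℕ, p.Prime → P.real {ω | j ≤ G k p ω} = ((p : ℝ) ^ j)⁻¹)
    (hindep : iIndepFun (fun i : ℕ × Nat.Primes => G i.1 i.2) P) (m : ℕ) :
    iIndepSet (fun p : Nat.Primes => zeroEvent G m p) P := by
  rw [iIndepSet_iff_meas_biInter fun p => measurableSet_zeroEvent hmeas m p.2]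
  intro S
  rw [measure_biInter_zeroEvent hmeas hgeom hindep]
  refine Finset.prod_congr rfl fun p _ => ?_
  rw [← ofReal_measureReal, measureReal_zeroEvent hmeas hgeom hindep]

lemma measurable_bernoulliTerm (hmeas : ∀ k p : ℕ, p.Prime → Measurable (G k p)) (c : ℝ) (m : ℕ)
    {p : ℕ} (hp : p.Prime) : Measurable (bernoulliTerm G c m p) := by
  have : Measurable ((zeroEvent G m p).indicator fun _ => (1 : ℝ)) :=
    measurable_const.indicator (measurableSet_zeroEvent hmeas m hp)
  unfold bernoulliTerm
  fun_prop

lemma iIndepFun_bernoulliTerm (hmeas : ∀ k p : ℕ, p.Prime → Measurable (G k p))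
    (hgeom : ∀ k p j : ℕ, p.Prime → P.real {ω | j ≤ G k p ω} = ((p : ℝ) ^ j)⁻¹)
    (hindep : iIndepFun (fun i : ℕ × Nat.Primes => G i.1 i.2) P) (c : ℝ) (m : ℕ) :
    iIndepFun (fun p : Nat.Primes => bernoulliTerm G c m p) P :=
  (iIndepSet_zeroEvent hmeas hgeom hindep m).iIndepFun_indicator (β := ℝ).comp
    (fun p x => Real.log (p : ℕ) * (zeroProb m p - x) / c) fun p => by fun_prop

lemma integral_bernoulliTerm (hmeas : ∀ k p : ℕ, p.Prime → Measurable (G k p))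
    (hgeom : ∀ k p j : ℕ, p.Prime → P.real {ω | j ≤ G k p ω} = ((p : ℝ) ^ j)⁻¹)
    (hindep : iIndepFun (fun i : ℕ × Nat.Primes => G i.1 i.2) P) (c : ℝ) (m : ℕ)
    (p : Nat.Primes) : ∫ ω, bernoulliTerm G c m p ω ∂P = 0 := by
  have hms := measurableSet_zeroEvent hmeas m p.2
  have hi : Integrable ((zeroEvent G m p).indicator fun _ => (1 : ℝ)) P :=
    (integrable_const 1).indicator hms
  unfold bernoulliTerm
  rw [integral_div, integral_const_mul, integral_sub (integrable_const _) hi,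
    integral_indicator_const _ hms, measureReal_zeroEvent hmeas hgeom hindep]
  simp

lemma integral_bernoulliTerm_sq (hmeas : ∀ k p : ℕ, p.Prime → Measurable (G k p))
    (hgeom : ∀ k p j : ℕ, p.Prime → P.real {ω | j ≤ G k p ω} = ((p : ℝ) ^ j)⁻¹)
    (hindep : iIndepFun (fun i : ℕ × Nat.Primes => G i.1 i.2) P) (c : ℝ) (m : ℕ)
    (p : Nat.Primes) : ∫ ω, bernoulliTerm G c m p ω ^ 2 ∂P =
      Real.log (p : ℕ) ^ 2 * (zeroProb m p * (1 - zeroProb m p)) / c ^ 2 := by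
  have hms := measurableSet_zeroEvent hmeas m p.2
  set r := zeroProb m p with hr
  have hi : Integrable ((zeroEvent G m p).indicator fun _ => (1 : ℝ)) P :=
    (integrable_const 1).indicator hms
  have e (ω : Ω) : bernoulliTerm G c m p ω ^ 2 = Real.log (p : ℕ) ^ 2 / c ^ 2 *
      (r ^ 2 + (1 - 2 * r) * (zeroEvent G m p).indicator (fun _ => (1 : ℝ)) ω) := by
    rw [bernoulliTerm]
    by_cases h : ω ∈ zeroEvent G m p
    · rw [Set.indicator_of_mem h]; ring
    · rw [Set.indicator_of_notMem h]; ring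
  simp_rw [e]
  rw [integral_const_mul, integral_add (integrable_const _) (hi.const_mul _), integral_const_mul,
    integral_indicator_const _ hms, measureReal_zeroEvent hmeas hgeom hindep, ← hr]
  simp only [integral_const, probReal_univ, smul_eq_mul]
  ring

lemma measureReal_le_maxCopies_le
    (hgeom : ∀ k p j : ℕ, p.Prime → P.real {ω | j ≤ G k p ω} = ((p : ℝ) ^ j)⁻¹) (m : ℕ) {p j : ℕ}
    (hp : p.Prime) (hj : 1 ≤ j) :
    P.real {ω | j ≤ maxCopies G m p ω} ≤ (m : ℝ) / (p : ℝ) ^ j := by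
  have h1 : {ω | j ≤ maxCopies G m p ω} ⊆ ⋃ k ∈ Finset.range m, {ω | j ≤ G k p ω} := by
    intro ω hω
    obtain ⟨k, hk, h⟩ := (Finset.le_sup_iff (Nat.lt_of_lt_of_le Nat.zero_lt_one hj)).1 hω
    exact Set.mem_biUnion hk h
  calc _ ≤ P.real (⋃ k ∈ Finset.range m, {ω | j ≤ G k p ω}) := measureReal_mono h1 (measure_ne_top _ _)
    _ ≤ ∑ k ∈ Finset.range m, P.real {ω | j ≤ G k p ω} := measureReal_biUnion_finset_le _ _
    _ = _ := by
      rw [Finset.sum_congr rfl fun k _ => hgeom k p j hp]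
      simp [div_eq_mul_inv]

/-- By the layer cake formula, `E (T - 1)⁺ = ∑_{j ≥ 2} P(T ≥ j)`, and `P(T ≥ j) ≤ min(1, m p⁻ʲ)`. The
terms `j ≥ 3` are bounded by `√(m p⁻ʲ)` and summed as a geometric series of ratio
`p^(-1/2) ≤ 3/4`. -/
lemma lintegral_maxCopies_sub_one_le (hmeas : ∀ k p : ℕ, p.Prime → Measurable (G k p))
    (hgeom : ∀ k p j : ℕ, p.Prime → P.real {ω | j ≤ G k p ω} = ((p : ℝ) ^ j)⁻¹) (m : ℕ) {p : ℕ}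
    (hp : p.Prime) :
    ∫⁻ ω, ((maxCopies G m p ω - 1 : ℕ) : ENNReal) ∂P ≤
      ENNReal.ofReal (min 1 ((m : ℝ) / (p : ℝ) ^ 2) + 4 * (√m / (p * √p))) := by
  have hp0 : (0 : ℝ) < p := by exact_mod_cast hp.pos
  have hp2 : (2 : ℝ) ≤ p := by exact_mod_cast hp.two_le
  have hT := measurable_maxCopies hmeas m hp
  have hset (j : ℕ) : MeasurableSet {ω | j + 2 ≤ maxCopies G m p ω} :=
    measurableSet_le measurable_const hT
  have hlayer (ω : Ω) : ((maxCopies G m p ω - 1 : ℕ) : ENNReal) =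
      ∑' j : ℕ, {ω | j + 2 ≤ maxCopies G m p ω}.indicator (fun _ => (1 : ENNReal)) ω := by
    rw [tsum_eq_sum (s := Finset.range (maxCopies G m p ω - 1))]
    · rw [Finset.sum_congr rfl (g := fun _ => (1 : ENNReal))]
      · simp
      · intro j hj
        rw [Finset.mem_range] at hj
        have h : ω ∈ {ω | j + 2 ≤ maxCopies G m p ω} := by rw [Set.mem_ofPred_eq]; omega
        rw [Set.indicator_of_mem h]
    · intro j hj
      rw [Finset.mem_range] at hj
      have h : ω ∉ {ω | j + 2 ≤ maxCopies G m p ω} := by rw [Set.mem_ofPred_eq]; omega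
      rw [Set.indicator_of_notMem h]
  have hprob (j : ℕ) : P {ω | j + 2 ≤ maxCopies G m p ω} ≤
      ENNReal.ofReal (min 1 ((m : ℝ) / (p : ℝ) ^ (j + 2))) := by
    rw [← ofReal_measureReal]
    exact ENNReal.ofReal_le_ofReal
      (le_min measureReal_le_one (measureReal_le_maxCopies_le hgeom m hp (by omega)))
  have hsq0 : 0 < √(p : ℝ) := Real.sqrt_pos.2 hp0
  set q : ℝ := 1 / √p with hq
  have hq0 : 0 ≤ q := by positivity
  have hq1 : q ≤ 3 / 4 := by
    rw [hq, div_le_div_iff₀ hsq0 (by norm_num)]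
    have : (4 / 3 : ℝ) ≤ √p := Real.le_sqrt_of_sq_le (by linarith)
    linarith
  have htail (j : ℕ) : P {ω | j + 1 + 2 ≤ maxCopies G m p ω} ≤
      ENNReal.ofReal (√m / (p * √p) * q ^ j) := by
    refine (hprob (j + 1)).trans (ENNReal.ofReal_le_ofReal ?_)
    set x := (m : ℝ) / (p : ℝ) ^ (j + 1 + 2) with hx
    have hx0 : 0 ≤ x := by positivity
    have h1 : min 1 x ≤ √x := by
      refine Real.le_sqrt_of_sq_le ?_
      have h2 : 0 ≤ min 1 x := le_min zero_le_one hx0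
      calc min 1 x ^ 2 = min 1 x * min 1 x := sq _
        _ ≤ 1 * x := mul_le_mul (min_le_left _ _) (min_le_right _ _) h2 zero_le_one
        _ = x := one_mul x
    refine h1.trans (le_of_eq ?_)
    have h3 : (p : ℝ) ^ (j + 1 + 2) = (p * √p * √p ^ j) ^ 2 := by
      have := Real.sq_sqrt hp0.le
      calc (p : ℝ) ^ (j + 1 + 2) = p ^ 2 * p * p ^ j := by ring
        _ = p ^ 2 * √p ^ 2 * (√p ^ 2) ^ j := by rw [this]
        _ = _ := by ring
    rw [hx, h3, Real.sqrt_div (Nat.cast_nonneg m), Real.sqrt_sq (by positivity), hq, div_pow, one_pow]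
    field_simp
  have hgeomsum : ∑' j : ℕ, ENNReal.ofReal (√m / (p * √p) * q ^ j) ≤
      ENNReal.ofReal (4 * (√m / (p * √p))) := by
    have hs : Summable fun j : ℕ => √(m : ℝ) / (p * √p) * q ^ j :=
      (summable_geometric_of_lt_one hq0 (by linarith)).mul_left _
    rw [← ENNReal.ofReal_tsum_of_nonneg (fun j => by positivity) hs, tsum_mul_left,
      tsum_geometric_of_lt_one hq0 (by linarith)]
    refine ENNReal.ofReal_le_ofReal ?_
    rw [mul_comm]
    refine mul_le_mul_of_nonneg_right ?_ (by positivity)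
    rw [inv_le_comm₀ (by linarith) (by norm_num)]
    linarith
  simp_rw [hlayer]
  rw [lintegral_tsum fun j => (measurable_const.indicator (hset j)).aemeasurable]
  simp_rw [lintegral_indicator_const (hset _), one_mul]
  rw [tsum_eq_zero_add' ENNReal.summable, ENNReal.ofReal_add
    (le_min zero_le_one (by positivity)) (by positivity)]
  exact add_le_add (hprob 0) ((ENNReal.tsum_le_tsum htail).trans hgeomsum)

lemma measurable_excess (hmeas : ∀ k p : ℕ, p.Prime → Measurable (G k p)) (n m : ℕ) :
    Measurable (excess G n m) := by
  refine Finset.measurable_sum _ fun p hp => ?_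
  have h := measurable_maxCopies hmeas m (Nat.prime_of_mem_primesLE hp)
  exact ((measurable_from_top (f := fun k : ℕ => ((k - 1 : ℕ) : ℝ))).comp h).const_mul _

/-- The excess is `O(√m)` in `L¹`, uniformly in `n`. -/
lemma exists_lintegral_excess_le (hmeas : ∀ k p : ℕ, p.Prime → Measurable (G k p))
    (hgeom : ∀ k p j : ℕ, p.Prime → P.real {ω | j ≤ G k p ω} = ((p : ℝ) ^ j)⁻¹) :
    ∃ C : ℝ, 0 ≤ C ∧ ∀ m n : ℕ, 1 ≤ m →
      ∫⁻ ω, ‖excess G n m ω‖ₑ ∂P ≤ ENNReal.ofReal (C * √m) := by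
  obtain ⟨C, hC0, hC⟩ := exists_sum_log_mul_min_le
  refine ⟨C, hC0, fun m n hm => ?_⟩
  have hlog0 (p : ℕ) : 0 ≤ Real.log p := Real.log_natCast_nonneg p
  have henorm (ω : Ω) : ‖excess G n m ω‖ₑ =
      ∑ p ∈ Nat.primesLE n, ENNReal.ofReal (Real.log p) * ((maxCopies G m p ω - 1 : ℕ) : ENNReal) := by
    have hterm (p : ℕ) : 0 ≤ Real.log p * ((maxCopies G m p ω - 1 : ℕ) : ℝ) :=
      mul_nonneg (hlog0 p) (Nat.cast_nonneg _)
    rw [excess, Real.enorm_of_nonneg (Finset.sum_nonneg fun p _ => hterm p),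
      ENNReal.ofReal_sum_of_nonneg fun p _ => hterm p]
    refine Finset.sum_congr rfl fun p _ => ?_
    rw [ENNReal.ofReal_mul (hlog0 p), ENNReal.ofReal_natCast]
  have hmeasT (p : ℕ) (hp : p ∈ Nat.primesLE n) :
      Measurable fun ω => ((maxCopies G m p ω - 1 : ℕ) : ENNReal) :=
    (measurable_from_top (f := fun k : ℕ => ((k - 1 : ℕ) : ENNReal))).comp
      (measurable_maxCopies hmeas m (Nat.prime_of_mem_primesLE hp))
  simp_rw [henorm]
  rw [lintegral_finsetSum' _ fun p hp => ((hmeasT p hp).const_mul _).aemeasurable]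
  calc _ ≤ ∑ p ∈ Nat.primesLE n, ENNReal.ofReal (Real.log p *
        (min 1 ((m : ℝ) / (p : ℝ) ^ 2) + 4 * (√m / (p * √p)))) := by
        refine Finset.sum_le_sum fun p hp => ?_
        rw [lintegral_const_mul _ (hmeasT p hp), ENNReal.ofReal_mul (hlog0 p)]
        gcongr
        exact lintegral_maxCopies_sub_one_le hmeas hgeom m (Nat.prime_of_mem_primesLE hp)
    _ = ENNReal.ofReal (∑ p ∈ Nat.primesLE n, Real.log p *
        (min 1 ((m : ℝ) / (p : ℝ) ^ 2) + 4 * (√m / (p * √p)))) := by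
        rw [ENNReal.ofReal_sum_of_nonneg]
        intro p _
        exact mul_nonneg (hlog0 p) (add_nonneg (le_min zero_le_one (by positivity)) (by positivity))
    _ ≤ _ := ENNReal.ofReal_le_ofReal (hC m n hm)

end GeometricModel

/-! ### Asymptotics of the norming -/

section Asymptotics

variable {m : ℕ → ℕ}

lemma eventually_one_le_and_le (hm : Tendsto m atTop atTop)
    (hmn : (fun n => (m n : ℝ)) =o[atTop] (fun n : ℕ => (n : ℝ))) :
    ∀ᶠ n in atTop, 1 ≤ m n ∧ m n ≤ n := by
  filter_upwards [hm.eventually_ge_atTop 1, hmn.bound zero_lt_one] with n h1 h2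
  refine ⟨h1, ?_⟩
  rw [one_mul, Real.norm_natCast, Real.norm_natCast] at h2
  exact_mod_cast h2

lemma tendsto_log_sub_log_atTop (hm : Tendsto m atTop atTop)
    (hmn : (fun n => (m n : ℝ)) =o[atTop] (fun n : ℕ => (n : ℝ))) :
    Tendsto (fun n : ℕ => Real.log n - Real.log (m n)) atTop atTop := by
  have hev := eventually_one_le_and_le hm hmn
  have h1 : Tendsto (fun n : ℕ => (m n : ℝ) / n) atTop (𝓝[>] 0) := by
    refine tendsto_nhdsWithin_iff.2 ⟨hmn.tendsto_div_nhds_zero, ?_⟩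
    filter_upwards [hev] with n hn
    have h1 : (0 : ℝ) < m n := by exact_mod_cast hn.1
    have h2 : (0 : ℝ) < n := by exact_mod_cast hn.1.trans hn.2
    exact div_pos h1 h2
  refine (tendsto_neg_atBot_atTop.comp (Real.tendsto_log_nhdsGT_zero.comp h1)).congr' ?_
  filter_upwards [hev] with n hn
  have h2 : (m n : ℝ) ≠ 0 := by exact_mod_cast (by omega : m n ≠ 0)
  have h3 : (n : ℝ) ≠ 0 := by exact_mod_cast (by omega : n ≠ 0)
  simp only [Function.comp_apply]
  rw [Real.log_div h2 h3]
  ring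

lemma geomNormSq_eq (n m : ℕ) : geomNormSq n m =
    m * (Real.log n - Real.log m) * (Real.log n + Real.log m) / 2 := by
  rw [geomNormSq]; ring

/-- Simultaneous conditions, valid for large `n`, under which the norming is nondegenerate. -/
lemma eventually_regular (hm : Tendsto m atTop atTop)
    (hmn : (fun n => (m n : ℝ)) =o[atTop] (fun n : ℕ => (n : ℝ))) :
    ∀ᶠ n : ℕ in atTop, 1 ≤ m n ∧ m n ≤ n ∧ 0 < Real.log (m n) ∧ 1 ≤ Real.log n ∧
      0 < Real.log n - Real.log (m n) ∧ 0 < geomNormSq n (m n) := by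
  filter_upwards [eventually_one_le_and_le hm hmn, hm.eventually_ge_atTop 2,
    (Real.tendsto_log_atTop.comp tendsto_natCast_atTop_atTop).eventually_ge_atTop 1,
    (tendsto_log_sub_log_atTop hm hmn).eventually_gt_atTop 0] with n h1 h2 h3 h4
  have h3 : 1 ≤ Real.log (n : ℝ) := h3
  have hM : 0 < Real.log (m n) := Real.log_pos (by exact_mod_cast h2)
  have hm0 : (0 : ℝ) < m n := by exact_mod_cast h1.1
  refine ⟨h1.1, h1.2, hM, h3, h4, ?_⟩
  rw [geomNormSq_eq]
  have : 0 < Real.log n + Real.log (m n) := by linarith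
  positivity

lemma tendsto_mul_log_div_geomNormSq (hm : Tendsto m atTop atTop)
    (hmn : (fun n => (m n : ℝ)) =o[atTop] (fun n : ℕ => (n : ℝ))) :
    Tendsto (fun n : ℕ => (m n : ℝ) * Real.log n / geomNormSq n (m n)) atTop (𝓝 0) := by
  have hlim : Tendsto (fun n : ℕ => 2 / (Real.log n - Real.log (m n))) atTop (𝓝 0) :=
    tendsto_const_nhds.div_atTop (tendsto_log_sub_log_atTop hm hmn)
  refine squeeze_zero' ?_ ?_ hlim
  · filter_upwards [eventually_regular hm hmn] with n ⟨_, _, _, hL, _, hb⟩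
    positivity
  · filter_upwards [eventually_regular hm hmn] with n ⟨h1, _, hM, hL, hD, hb⟩
    have hm0 : (0 : ℝ) < m n := by exact_mod_cast h1
    rw [div_le_div_iff₀ hb hD, geomNormSq_eq]
    have : 0 ≤ m n * (Real.log n - Real.log (m n)) * Real.log (m n) := by positivity
    linarith

/-- Each Bernoulli term is negligible. With `D = log n - log m`, one has
`log n = D + log m ≤ D + m`, whence `log² n / b ≤ 2 (1 / m + 1 / D)`. -/
lemma tendsto_log_sq_div_geomNormSq (hm : Tendsto m atTop atTop)
    (hmn : (fun n => (m n : ℝ)) =o[atTop] (fun n : ℕ => (n : ℝ))) :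
    Tendsto (fun n : ℕ => Real.log n ^ 2 / geomNormSq n (m n)) atTop (𝓝 0) := by
  have hlim : Tendsto (fun n : ℕ => 2 * (1 / (m n : ℝ) + 1 / (Real.log n - Real.log (m n))))
      atTop (𝓝 0) := by
    have h1 : Tendsto (fun n : ℕ => 1 / (m n : ℝ)) atTop (𝓝 0) :=
      tendsto_const_nhds.div_atTop (tendsto_natCast_atTop_atTop.comp hm)
    have h2 : Tendsto (fun n : ℕ => 1 / (Real.log n - Real.log (m n))) atTop (𝓝 0) :=
      tendsto_const_nhds.div_atTop (tendsto_log_sub_log_atTop hm hmn)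
    simpa using (h1.add h2).const_mul 2
  refine squeeze_zero' ?_ ?_ hlim
  · filter_upwards [eventually_regular hm hmn] with n ⟨_, _, _, hL, _, hb⟩
    positivity
  · filter_upwards [eventually_regular hm hmn] with n ⟨h1, _, hM, hL, hD, hb⟩
    have hm0 : (0 : ℝ) < m n := by exact_mod_cast h1
    have hMm : Real.log (m n) ≤ m n := Real.log_le_self hm0.le
    have e : 2 * (1 / (m n : ℝ) + 1 / (Real.log n - Real.log (m n))) =
        2 * ((Real.log n - Real.log (m n)) + m n) / (m n * (Real.log n - Real.log (m n))) := by
      field_simp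
    rw [e, div_le_div_iff₀ hb (by positivity), geomNormSq_eq]
    set D := Real.log n - Real.log (m n)
    have h2 : Real.log n ^ 2 ≤ (D + m n) * (Real.log n + Real.log (m n)) := by
      have h3 : Real.log n ≤ D + m n := by simp only [D]; linarith
      rw [sq]
      exact mul_le_mul h3 (by linarith) (by linarith) (by linarith)
    calc _ ≤ (D + m n) * (Real.log n + Real.log (m n)) * (m n * D) := by gcongr
      _ = _ := by ring

lemma tendsto_log_div_sqrt_geomNormSq (hm : Tendsto m atTop atTop)
    (hmn : (fun n => (m n : ℝ)) =o[atTop] (fun n : ℕ => (n : ℝ))) :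
    Tendsto (fun n : ℕ => Real.log n / √(geomNormSq n (m n))) atTop (𝓝 0) := by
  have h := (tendsto_log_sq_div_geomNormSq hm hmn).sqrt
  rw [Real.sqrt_zero] at h
  refine h.congr fun n => ?_
  rw [Real.sqrt_div (sq_nonneg _), Real.sqrt_sq (Real.log_natCast_nonneg n)]

lemma tendsto_sqrt_div_sqrt_geomNormSq (hm : Tendsto m atTop atTop)
    (hmn : (fun n => (m n : ℝ)) =o[atTop] (fun n : ℕ => (n : ℝ))) :
    Tendsto (fun n : ℕ => √(m n : ℝ) / √(geomNormSq n (m n))) atTop (𝓝 0) := by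
  have h1 : Tendsto (fun n : ℕ => (m n : ℝ) / geomNormSq n (m n)) atTop (𝓝 0) := by
    refine squeeze_zero' ?_ ?_ (tendsto_mul_log_div_geomNormSq hm hmn)
    · filter_upwards [eventually_regular hm hmn] with n ⟨_, _, _, _, _, hb⟩
      positivity
    · filter_upwards [eventually_regular hm hmn] with n ⟨_, _, _, hL, _, hb⟩
      gcongr
      exact le_mul_of_one_le_right (Nat.cast_nonneg _) hL
  have h := h1.sqrt
  rw [Real.sqrt_zero] at h
  refine h.congr fun n => ?_
  rw [Real.sqrt_div (Nat.cast_nonneg _)]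

lemma tendsto_variance_div_geomNormSq (hm : Tendsto m atTop atTop)
    (hmn : (fun n => (m n : ℝ)) =o[atTop] (fun n : ℕ => (n : ℝ))) :
    Tendsto (fun n : ℕ => (∑ p ∈ Nat.primesLE n,
      Real.log p ^ 2 * (zeroProb (m n) p * (1 - zeroProb (m n) p))) / geomNormSq n (m n))
      atTop (𝓝 1) := by
  obtain ⟨C, hC0, hC⟩ := exists_abs_variance_sub_geomNormSq_le
  rw [tendsto_iff_norm_sub_tendsto_zero]
  have hlim := (tendsto_mul_log_div_geomNormSq hm hmn).const_mul C
  rw [mul_zero] at hlim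
  refine squeeze_zero' (Eventually.of_forall fun n => norm_nonneg _) ?_ hlim
  filter_upwards [eventually_regular hm hmn] with n ⟨h1, h2, _, _, _, hb⟩
  rw [div_sub_one hb.ne', norm_div, Real.norm_of_nonneg hb.le, ← mul_div_assoc]
  gcongr
  exact hC (m n) n h1 h2

/-- In terms of `x = log n / log m > 1`, the ratio of the two normings is `(x + 1) / (3 - x)` if
`x < 2`, and `x² - 1 ≥ 3` otherwise. -/
lemma geomNormSq_div_lcmNormSq {n m : ℕ} (hm : 1 ≤ m) (hn : 1 ≤ n) (hM : 0 < Real.log m)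
    (hD : 0 < Real.log n - Real.log m) :
    (Real.log n / Real.log m < 2 ∧ geomNormSq n m / lcmNormSq n m =
      (Real.log n / Real.log m + 1) / (3 - Real.log n / Real.log m)) ∨
    (2 ≤ Real.log n / Real.log m ∧ 3 ≤ geomNormSq n m / lcmNormSq n m) := by
  have hm0 : (0 : ℝ) < m := by exact_mod_cast hm
  have hn0 : (0 : ℝ) < n := by exact_mod_cast hn
  have hiff : (m : ℝ) ≤ √n ↔ 2 ≤ Real.log n / Real.log m := by
    rw [← Real.log_le_log_iff hm0 (Real.sqrt_pos.2 hn0), Real.log_sqrt hn0.le, le_div_iff₀ hM,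
      le_div_iff₀ zero_lt_two, mul_comm]
  rw [lcmNormSq]
  by_cases h : (m : ℝ) ≤ √n
  · right
    rw [if_pos h]
    have hx := hiff.1 h
    refine ⟨hx, ?_⟩
    have e : geomNormSq n m / (m * Real.log m ^ 2 / 2) = (Real.log n / Real.log m) ^ 2 - 1 := by
      rw [geomNormSq]; field_simp
    rw [e]
    nlinarith
  · left
    rw [if_neg h]
    have hx := not_le.1 (mt hiff.2 h)
    refine ⟨hx, ?_⟩
    rw [div_lt_iff₀ hM] at hx
    have h3 : 3 * Real.log m - Real.log n ≠ 0 := by linarith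
    have e : (Real.log n / Real.log m + 1) / (3 - Real.log n / Real.log m) =
        (Real.log n + Real.log m) / (3 * Real.log m - Real.log n) := by
      have : 3 - Real.log n / Real.log m = (3 * Real.log m - Real.log n) / Real.log m := by
        field_simp
      rw [this]
      field_simp
    rw [e, geomNormSq_eq]
    have hD' := hD.ne'
    field_simp

lemma tendsto_geomNormSq_div_lcmNormSq_iff (hm : Tendsto m atTop atTop)
    (hmn : (fun n => (m n : ℝ)) =o[atTop] (fun n : ℕ => (n : ℝ))) :
    Tendsto (fun n : ℕ => geomNormSq n (m n) / lcmNormSq n (m n)) atTop (𝓝 1) ↔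
      Tendsto (fun n : ℕ => Real.log n / Real.log (m n)) atTop (𝓝 1) := by
  have hev : ∀ᶠ n : ℕ in atTop, _ := (eventually_regular hm hmn).mono
    fun n ⟨h1, h2, hM, _, hD, _⟩ => geomNormSq_div_lcmNormSq h1 (h1.trans h2) hM hD
  constructor
  · intro h
    -- `ρ = (x + 1) / (3 - x)` is solved by `x = (3ρ - 1) / (ρ + 1)`
    have hlim : Tendsto (fun n : ℕ => (3 * (geomNormSq n (m n) / lcmNormSq n (m n)) - 1) /
        (geomNormSq n (m n) / lcmNormSq n (m n) + 1)) atTop (𝓝 ((3 * 1 - 1) / (1 + 1))) :=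
      ((h.const_mul 3).sub_const 1).div (h.add_const 1) (by norm_num)
    norm_num at hlim
    refine hlim.congr' ?_
    filter_upwards [hev, h.eventually_lt_const (by norm_num : (1 : ℝ) < 3)] with n hn h3
    rcases hn with ⟨hx, hρ⟩ | ⟨_, hρ⟩
    · rw [hρ]
      have : 3 - Real.log n / Real.log (m n) ≠ 0 := by linarith
      set x := Real.log n / Real.log (m n)
      field_simp
      ring
    · exact absurd hρ (not_le.2 h3)
  · intro h
    have hlim : Tendsto (fun n : ℕ => (Real.log n / Real.log (m n) + 1) /
        (3 - Real.log n / Real.log (m n))) atTop (𝓝 ((1 + 1) / (3 - 1))) :=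
      (h.add_const 1).div (h.const_sub 3) (by norm_num)
    norm_num at hlim
    refine hlim.congr' ?_
    filter_upwards [hev, h.eventually_lt_const (by norm_num : (1 : ℝ) < 2)] with n hn h2
    rcases hn with ⟨_, hρ⟩ | ⟨hx, _⟩
    · exact hρ.symm
    · exact absurd hx (not_le.2 h2)

end Asymptotics

/-! ### The central limit theorem for the geometric model -/

theorem proposition8p1 {Ω : Type*} [MeasurableSpace Ω] (P : Measure Ω) [IsProbabilityMeasure P]
    -- `G k p`, for `k : ℕ` and `p` prime, are independent, `G k p` having `P(G k p ≥ j) = p⁻ʲ`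
    (G : ℕ → ℕ → Ω → ℕ)
    (hmeas : ∀ k p : ℕ, p.Prime → Measurable (G k p))
    (hgeom : ∀ k p j : ℕ, p.Prime → P.real {ω | j ≤ G k p ω} = ((p : ℝ) ^ j)⁻¹)
    (hindep : iIndepFun (fun i : ℕ × Nat.Primes => G i.1 i.2) P)
    (m : ℕ → ℕ) (hm : Tendsto m atTop atTop)
    (hmn : (fun n => (m n : ℝ)) =o[atTop] (fun n : ℕ => (n : ℝ))) :
    -- convergence in distribution to a standard normal random variable
    TendstoInDistribution
      (fun (n : ℕ) ω => (geomLogLcm G n (m n) ω - geomCentering n (m n)) / √(geomNormSq n (m n)))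
      atTop (id : ℝ → ℝ) (fun _ => P) (gaussianReal 0 1) ∧
    -- comparison of the two normings
    (Tendsto (fun n : ℕ => geomNormSq n (m n) / lcmNormSq n (m n)) atTop (𝓝 1) ↔
      Tendsto (fun n : ℕ => Real.log n / Real.log (m n)) atTop (𝓝 1)) := by
  refine ⟨?_, tendsto_geomNormSq_div_lcmNormSq_iff hm hmn⟩
  have hclt : TendstoInDistribution (fun (n : ℕ) ω => ∑ p ∈ primesUpTo n,
      bernoulliTerm G (√(geomNormSq n (m n))) (m n) p ω) atTop (id : ℝ → ℝ) (fun _ => P)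
      (gaussianReal 0 1) := by
    refine tendstoInDistribution_sum_of_bounded
      (X := fun n (p : Nat.Primes) => bernoulliTerm G (√(geomNormSq n (m n))) (m n) p)
      primesUpTo
      (fun n p => measurable_bernoulliTerm hmeas _ _ p.2)
      (fun n => iIndepFun_bernoulliTerm hmeas hgeom hindep _ _)
      (Eventually.of_forall fun n p hp ω => ?_) (tendsto_log_div_sqrt_geomNormSq hm hmn)
      (fun n p => integral_bernoulliTerm hmeas hgeom hindep _ _ p) ?_
    · refine (abs_bernoulliTerm_le (Real.sqrt_nonneg _) _ p.2 ω).trans ?_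
      have h1 : (0 : ℝ) < (p : ℕ) := by exact_mod_cast p.2.pos
      have h2 : ((p : ℕ) : ℝ) ≤ n := by
        exact_mod_cast Nat.le_of_mem_primesLE (mem_primesUpTo.1 hp)
      gcongr
    · refine (tendsto_variance_div_geomNormSq hm hmn).congr' ?_
      filter_upwards [eventually_regular hm hmn] with n ⟨_, _, _, _, _, hb⟩
      simp_rw [integral_bernoulliTerm_sq hmeas hgeom hindep, ← Finset.sum_div, Real.sq_sqrt hb.le]
      rw [sum_primesUpTo fun p => Real.log p ^ 2 *
        (zeroProb (m n) p * (1 - zeroProb (m n) p))]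
  have hexcess : TendstoInMeasure P
      (fun (n : ℕ) ω => excess G n (m n) ω / √(geomNormSq n (m n))) atTop (fun _ => (0 : ℝ)) := by
    obtain ⟨C, hC0, hC⟩ := exists_lintegral_excess_le hmeas hgeom
    refine tendstoInMeasure_of_tendsto_eLpNorm one_ne_zero
      (fun n => ((measurable_excess hmeas n (m n)).div_const _).aestronglyMeasurable)
      aestronglyMeasurable_const ?_
    have hlim : Tendsto (fun n : ℕ => ENNReal.ofReal (C * (√(m n : ℝ) / √(geomNormSq n (m n)))))
        atTop (𝓝 0) := by
      have := ENNReal.tendsto_ofReal ((tendsto_sqrt_div_sqrt_geomNormSq hm hmn).const_mul C)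
      simpa using this
    refine tendsto_of_tendsto_of_tendsto_of_le_of_le' tendsto_const_nhds hlim
      (Eventually.of_forall fun n => zero_le) ?_
    filter_upwards [eventually_regular hm hmn] with n ⟨h1, _⟩
    rw [eLpNorm_one_eq_lintegral_enorm]
    simp only [Pi.sub_apply, sub_zero, div_eq_mul_inv, enorm_mul]
    rw [lintegral_mul_const _ (measurable_excess hmeas n (m n)).enorm,
      Real.enorm_of_nonneg (inv_nonneg.2 (Real.sqrt_nonneg _)), ← mul_assoc,
      ENNReal.ofReal_mul (by positivity)]
    gcongr
    exact hC (m n) n h1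
  have h := hclt.add_of_tendstoInMeasure_const hexcess
    fun n => ((measurable_excess hmeas n (m n)).div_const _).aemeasurable
  have e1 : (fun (n : ℕ) ω => (geomLogLcm G n (m n) ω - geomCentering n (m n)) /
      √(geomNormSq n (m n))) = fun (n : ℕ) => (fun ω => ∑ p ∈ primesUpTo n,
      bernoulliTerm G (√(geomNormSq n (m n))) (m n) p ω) +
      fun ω => excess G n (m n) ω / √(geomNormSq n (m n)) := by
    funext n ω
    exact geomLogLcm_sub_geomCentering_div n (m n) _ ω
  have e2 : (fun x : ℝ => id x + 0) = id := by funext x; simp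
  rw [e1]
  simpa only [e2] using h
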